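/- Let $\mathcal{A}, \mathcal{B}, \mathcal{X}, \mathcal{Y}$ be finite sets with $\mathcal{A}, \mathcal{B}$ nonempty. A two-player strategy $\Gamma = (D, E, \{\{R_a^x\}_{x}\}_{a}, \{\{S_b^y\}_{y}\}_{b}, \gamma)$ consists of finite-dimensional complex Hilbert spaces $D, E$, a POVM $\{R_a^x\}_{x \in \mathcal{X}}$ on $D$ for each $a \in \mathcal{A}$, a POVM $\{S_b^y\}_{y \in \mathcal{Y}}$ on $E$ for each $b \in \mathcal{B}$, and a density operator $\gamma$ on $D \otimes E$. It achieves the correlation $p_{ab}^{xy} = \mathrm{Tr}[(R_a^x \otimes S_b^y)\gamma]$, and a correlation is called classical if it is achieved by some strategy whose shared state is separable. Put $$\rho_{ab}^{xy} = \mathrm{Tr}_D\left[\sqrt{R_a^x \otimes S_b^y}\;\gamma\;\sqrt{R_a^x \otimes S_b^y}\right],$$ and for a finite family of positive semidefinite operators $\{\rho_i\}$ on a finite-dimensional Hilbert space $V$ let $\mathrm{Dist}\{\rho_i\} = \max \sum_i \mathrm{Tr}(T_i \rho_i)$, where the maximum is over all POVMs $\{T_i\}$ on $V$. For any two-player strategy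 $\Gamma$, achieving the correlation $(p_{ab}^{xy})$, let $$\delta = 1 - \frac{1}{|\mathcal{A}||\mathcal{B}|}\sum_{a \in \mathcal{A},\, b \in \mathcal{B},\, y \in \mathcal{Y}} \mathrm{Dist}\{\rho_{ab}^{xy} \mid x \in \mathcal{X}\}.$$ Then there exists a classical correlation $(\overline{p}_{ab}^{xy})$ such that $$\frac{1}{|\mathcal{A}||\mathcal{B}|}\sum_{a,b,x,y} \left|p_{ab}^{xy} - \overline{p}_{ab}^{xy}\right| \;\le\; \sqrt{3\delta}\,|\mathcal{A}|.$$ -/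

import Mathlib

open scoped Kronecker MatrixOrder ComplexOrder

namespace QuantumCorrelation

/- Operators on the finite-dimensional Hilbert space `ℂ^d` (`d` a finite type) are the matrices
`Matrix d d ℂ`; operators on `ℂ^d ⊗ ℂ^e = ℂ^(d × e)` are the matrices indexed by `d × e`,
with the Kronecker product `⊗ₖ` as tensor product of operators. -/

/-- A density operator: a positive semidefinite operator of trace one. -/
def IsDensity {d : Type*} [Fintype d] (ρ : Matrix d d ℂ) : Prop :=
  ρ.PosSemidef ∧ ρ.trace = 1

/-- A positive operator-valued measurement with outcomes in `ι`. -/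
def IsPOVM {ι d : Type*} [Fintype ι] [DecidableEq d] (T : ι → Matrix d d ℂ) : Prop :=
  (∀ i, (T i).PosSemidef) ∧ ∑ i, T i = 1

/-- The partial trace over the first tensor factor. -/
def partialTraceLeft {d e : Type*} [Fintype d] (M : Matrix (d × e) (d × e) ℂ) : Matrix e e ℂ :=
  Matrix.of fun j k => ∑ i, M (i, j) (i, k)

/-- A density operator on a bipartite system is separable if it is a convex combination of
products of density operators. -/
def IsSeparable {d e : Type*} [Fintype d] [Fintype e]
    (γ : Matrix (d × e) (d × e) ℂ) : Prop :=
  γ ∈ convexHull ℝ {τ | ∃ (σ : Matrix d d ℂ) (ω : Matrix e e ℂ),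
    IsDensity σ ∧ IsDensity ω ∧ τ = σ ⊗ₖ ω}

/-- The possible values of `∑ i, Tr (T i * ρ i)` as `T` ranges over all POVMs. -/
def guessValues {ι d : Type*} [Fintype ι] [Fintype d] [DecidableEq d]
    (ρ : ι → Matrix d d ℂ) : Set ℝ :=
  {r | ∃ T : ι → Matrix d d ℂ, IsPOVM T ∧ r = ∑ i, (T i * ρ i).trace.re}

/-- The distinguishability `Dist {ρ i}`: the maximum of `∑ i, Tr (T i * ρ i)` over all POVMs `T`.
The supremum is attained, see `isGreatest_distinguishability`. -/
noncomputable def distinguishability {ι d : Type*} [Fintype ι] [Fintype d] [DecidableEq d]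
    (ρ : ι → Matrix d d ℂ) : ℝ :=
  sSup (guessValues ρ)

/-- A two-player correlation with input alphabets `A`, `B` and output alphabets `X`, `Y`:
nonnegative, normalised and non-signaling. -/
structure Correlation (A B X Y : Type*) [Fintype X] [Fintype Y] where
  /-- `prob a b x y` is the probability of outputs `x`, `y` on inputs `a`, `b`. -/
  prob : A → B → X → Y → ℝ
  nonneg : ∀ a b x y, 0 ≤ prob a b x y
  sum_eq_one : ∀ a b, ∑ x, ∑ y, prob a b x y = 1
  nonsignaling_left : ∀ a x b b', ∑ y, prob a b x y = ∑ y, prob a b' x y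
  nonsignaling_right : ∀ b y a a', ∑ x, prob a b x y = ∑ x, prob a' b x y

/-- A two-player strategy whose players hold the Hilbert spaces `D = ℂ^d` and `E = ℂ^e`. -/
structure Strategy (A B X Y d e : Type*) [Fintype X] [Fintype Y]
    [Fintype d] [DecidableEq d] [Fintype e] [DecidableEq e] where
  /-- the measurements of the first player -/
  R : A → X → Matrix d d ℂ
  /-- the measurements of the second player -/
  S : B → Y → Matrix e e ℂ
  /-- the shared state -/
  γ : Matrix (d × e) (d × e) ℂ
  isPOVM_R : ∀ a, IsPOVM (R a)
  isPOVM_S : ∀ b, IsPOVM (S b)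
  isDensity_γ : IsDensity γ

/-! ### The maximum in the definition of the distinguishability is attained -/

theorem isClosed_setOf_posSemidef {d : Type*} [Fintype d] :
    IsClosed {M : Matrix d d ℂ | M.PosSemidef} := by
  have h : {M : Matrix d d ℂ | M.PosSemidef} =
      {M | M.conjTranspose = M} ∩ ⋂ x : d → ℂ, {M | 0 ≤ star x ⬝ᵥ M.mulVec x} := by
    ext M
    simp [Matrix.posSemidef_iff_dotProduct_mulVec, Matrix.IsHermitian]
  rw [h]
  refine (isClosed_eq (continuous_id.matrix_conjTranspose) continuous_id).inter
    (isClosed_iInter fun x => ?_)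
  exact isClosed_le continuous_const
    (continuous_const.dotProduct (continuous_id.matrix_mulVec continuous_const))

section

open scoped Matrix.Norms.L2Operator

theorem isCompact_setOf_isPOVM {ι d : Type*} [Fintype ι] [Fintype d] [DecidableEq d] :
    IsCompact {T : ι → Matrix d d ℂ | IsPOVM T} := by
  classical
  have : ProperSpace (Matrix d d ℂ) := FiniteDimensional.proper ℂ _
  refine IsCompact.of_isClosed_subset
    (isCompact_univ_pi fun _ : ι => isCompact_closedBall (0 : Matrix d d ℂ) 1) ?_ ?_
  · have h : {T : ι → Matrix d d ℂ | IsPOVM T} =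
        (⋂ i, {T | (T i).PosSemidef}) ∩ {T | ∑ i, T i = 1} := by
      ext T
      simp [IsPOVM]
    rw [h]
    refine (isClosed_iInter fun i =>
      (isClosed_setOf_posSemidef (d := d)).preimage (continuous_apply i)).inter ?_
    exact isClosed_eq (continuous_finsetSum _ fun i _ => continuous_apply i) continuous_const
  · rintro T ⟨hpos, hsum⟩ i -
    rw [mem_closedBall_zero_iff, CStarAlgebra.norm_le_one_iff_of_nonneg _ (hpos i).nonneg, ← hsum]
    exact Finset.single_le_sum (fun j _ => (hpos j).nonneg) (Finset.mem_univ i)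

end

theorem isGreatest_distinguishability {ι d : Type*} [Fintype ι] [Nonempty ι] [Fintype d]
    [DecidableEq d] (ρ : ι → Matrix d d ℂ) :
    IsGreatest (guessValues ρ) (distinguishability ρ) := by
  classical
  have himg : guessValues ρ =
      (fun T : ι → Matrix d d ℂ => ∑ i, (T i * ρ i).trace.re) '' {T | IsPOVM T} := by
    ext r
    constructor
    · rintro ⟨T, hT, rfl⟩
      exact ⟨T, hT, rfl⟩
    · rintro ⟨T, hT, rfl⟩
      exact ⟨T, hT, rfl⟩
  have hcomp : IsCompact (guessValues ρ) := by
    rw [himg]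
    refine isCompact_setOf_isPOVM.image ?_
    refine continuous_finsetSum _ fun i _ => Complex.continuous_re.comp ?_
    exact ((continuous_apply i).matrix_mul continuous_const).matrix_trace
  have hne : (guessValues ρ).Nonempty := by
    obtain ⟨i₀⟩ := ‹Nonempty ι›
    refine ⟨_, fun i => if i = i₀ then 1 else 0, ⟨fun i => ?_, ?_⟩, rfl⟩
    · by_cases h : i = i₀
      · simpa [h] using Matrix.PosSemidef.one
      · simpa [h] using Matrix.PosSemidef.zero
    · simp
  exact hcomp.isGreatest_sSup hne

theorem trace_mul_nonneg {n : Type*} [Fintype n] [DecidableEq n] {P Q : Matrix n n ℂ}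
    (hP : P.PosSemidef) (hQ : Q.PosSemidef) : 0 ≤ (P * Q).trace := by
  obtain ⟨M, rfl⟩ := (CStarAlgebra.nonneg_iff_eq_star_mul_self (a := P)).1 hP.nonneg
  rw [Matrix.mul_assoc, Matrix.trace_mul_comm]
  exact (hQ.mul_mul_conjTranspose_same M).trace_nonneg

namespace Strategy

variable {A B X Y d e : Type*} [Fintype X] [Fintype Y]
  [Fintype d] [DecidableEq d] [Fintype e] [DecidableEq e]

/-- The second player states
`ρ_{ab}^{xy} = Tr_D (√(R_a^x ⊗ S_b^y) γ √(R_a^x ⊗ S_b^y))`. -/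
noncomputable def secondPlayerState (Γ : Strategy A B X Y d e) (a : A) (b : B) (x : X) (y : Y) :
    Matrix e e ℂ :=
  partialTraceLeft
    (CFC.sqrt (Γ.R a x ⊗ₖ Γ.S b y) * Γ.γ * CFC.sqrt (Γ.R a x ⊗ₖ Γ.S b y))

theorem trace_nonneg (Γ : Strategy A B X Y d e) (a : A) (b : B) (x : X) (y : Y) :
    0 ≤ ((Γ.R a x ⊗ₖ Γ.S b y) * Γ.γ).trace :=
  trace_mul_nonneg (((Γ.isPOVM_R a).1 x).kronecker ((Γ.isPOVM_S b).1 y)) Γ.isDensity_γ.1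

theorem sum_right (Γ : Strategy A B X Y d e) (a : A) (b : B) (x : X) :
    ∑ y, ((Γ.R a x ⊗ₖ Γ.S b y) * Γ.γ).trace = ((Γ.R a x ⊗ₖ 1) * Γ.γ).trace := by
  have h : Γ.R a x ⊗ₖ (1 : Matrix e e ℂ) = ∑ y, Γ.R a x ⊗ₖ Γ.S b y := by
    rw [← (Γ.isPOVM_S b).2]
    ext i j
    simp [Matrix.sum_apply, Finset.mul_sum]
  rw [h, Finset.sum_mul, Matrix.trace_sum]

theorem sum_left (Γ : Strategy A B X Y d e) (a : A) (b : B) (y : Y) :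
    ∑ x, ((Γ.R a x ⊗ₖ Γ.S b y) * Γ.γ).trace = ((1 ⊗ₖ Γ.S b y) * Γ.γ).trace := by
  have h : (1 : Matrix d d ℂ) ⊗ₖ Γ.S b y = ∑ x, Γ.R a x ⊗ₖ Γ.S b y := by
    rw [← (Γ.isPOVM_R a).2]
    ext i j
    simp [Matrix.sum_apply, Finset.sum_mul]
  rw [h, Finset.sum_mul, Matrix.trace_sum]

theorem sum_one_left (Γ : Strategy A B X Y d e) (a : A) :
    ∑ x, ((Γ.R a x ⊗ₖ (1 : Matrix e e ℂ)) * Γ.γ).trace = 1 := by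
  have h : (1 : Matrix (d × e) (d × e) ℂ) = ∑ x, Γ.R a x ⊗ₖ (1 : Matrix e e ℂ) := by
    rw [← Matrix.one_kronecker_one, ← (Γ.isPOVM_R a).2]
    ext i j
    simp [Matrix.sum_apply, Finset.sum_mul]
  rw [← Matrix.trace_sum, ← Finset.sum_mul, ← h, one_mul, Γ.isDensity_γ.2]

/-- The correlation `p_{ab}^{xy} = Tr ((R_a^x ⊗ S_b^y) γ)` achieved by a strategy. (These traces
are real, see `coe_correlation_prob`.) -/
noncomputable def correlation (Γ : Strategy A B X Y d e) : Correlation A B X Y where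
  prob a b x y := ((Γ.R a x ⊗ₖ Γ.S b y) * Γ.γ).trace.re
  nonneg a b x y := (Complex.nonneg_iff.1 (Γ.trace_nonneg a b x y)).1
  sum_eq_one a b := by
    simp only [← Complex.re_sum, sum_right, sum_one_left, Complex.one_re]
  nonsignaling_left a x b b' := by
    simp only [← Complex.re_sum, sum_right]
  nonsignaling_right b y a a' := by
    simp only [← Complex.re_sum, sum_left]

theorem coe_correlation_prob (Γ : Strategy A B X Y d e) (a : A) (b : B) (x : X) (y : Y) :
    (Γ.correlation.prob a b x y : ℂ) = ((Γ.R a x ⊗ₖ Γ.S b y) * Γ.γ).trace :=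
  Complex.ext rfl (Complex.nonneg_iff.1 (Γ.trace_nonneg a b x y)).2

end Strategy

/-- A correlation is classical if it is achieved by a strategy with a separable shared state. -/
def Correlation.IsClassical {A B X Y : Type*} [Fintype X] [Fintype Y]
    (p : Correlation A B X Y) : Prop :=
  ∃ (m n : ℕ) (Γ : Strategy A B X Y (Fin m) (Fin n)), IsSeparable Γ.γ ∧ Γ.correlation = p

end QuantumCorrelation

namespace QuantumCorrelation

/-! ### Square roots of effects, partial traces and the expectation form. -/

section Matrices

/-! If the second player can guess the first player's outcome, then that outcome is nearly recorded
on the second side already, so measuring it hardly disturbs the joint statistics. Quantitatively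
(`sq_sum_abs_expectation_luders_le`), for an input pair with guessing error `D`, the Lüders update
moves the joint distribution of any first-side measurement with `S b` by at most `√(8 * D)` in ℓ¹
norm. The two situations behave like unit vectors with overlap at least `1 - D`, compared by a
Cauchy–Schwarz argument.

Hence all the `R a` can be measured in sequence on one system, which yields a joint measurement
(`IsJointlyMeasurable.update_luders`). Each `R a` suffers only from those measured before it;
putting the least disturbing ones first keeps the total error below `|A| / 2` times the sum of the
disturbances (`exists_isJointlyMeasurable_sum_le`). A joint measurement can be performed before the
inputs are known: its outcome is a classical register, and the state shared with the second player
becomes separable (`Strategy.exists_isClassical`). Averaging over inputs gives the constant `√(8 *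
δ) / 2 = √(2 * δ)`, slightly better than required. -/

theorem IsPOVM.le_one {ι d : Type*} [Fintype ι] [DecidableEq d]
    {T : ι → Matrix d d ℂ} (hT : IsPOVM T) (i : ι) : T i ≤ 1 := by
  rw [← hT.2]
  exact Finset.single_le_sum (fun j _ => (hT.1 j).nonneg) (Finset.mem_univ i)

variable {ι d e : Type*} [Fintype ι] [Fintype d] [Fintype e]

theorem posSemidef_mul_mul_self {M H : Matrix d d ℂ} (hM : M.PosSemidef) (hH : H.IsHermitian) :
    (H * M * H).PosSemidef := by
  have h := hM.mul_mul_conjTranspose_same H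
  rwa [hH.eq] at h

theorem IsDensity.nonempty {γ : Matrix d d ℂ} (hγ : IsDensity γ) : Nonempty d := by
  by_contra h
  rw [not_nonempty_iff] at h
  have h1 := hγ.2
  simp [Matrix.trace] at h1

theorem posSemidef_partialTraceLeft {d e : Type*} [Fintype d] {M : Matrix (d × e) (d × e) ℂ} (hM : M.PosSemidef) :
    (partialTraceLeft M).PosSemidef := by
  have h : partialTraceLeft M = ∑ i, M.submatrix (Prod.mk i) (Prod.mk i) := by
    ext j k
    simp [partialTraceLeft, Matrix.sum_apply]
  rw [h]
  exact Matrix.posSemidef_sum _ fun i _ => hM.submatrix _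

variable [DecidableEq d] [DecidableEq e]

theorem isHermitian_sqrt (M : Matrix d d ℂ) : (CFC.sqrt M).IsHermitian :=
  (Matrix.nonneg_iff_posSemidef.1 (CFC.sqrt_nonneg M)).1

theorem IsPOVM.sqrt_mul_sqrt {T : ι → Matrix d d ℂ} (hT : IsPOVM T) (i : ι) :
    CFC.sqrt (T i) * CFC.sqrt (T i) = T i :=
  CFC.sqrt_mul_sqrt_self _ (hT.1 i).nonneg

section

open scoped Matrix.Norms.L2Operator

theorem IsPOVM.sqrt_le_one {T : ι → Matrix d d ℂ} (hT : IsPOVM T) (i : ι) :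
    CFC.sqrt (T i) ≤ 1 := by
  have h := CFC.sqrt_le_sqrt (T i) 1 (hT.le_one i)
  rwa [CFC.sqrt_one] at h

end

/-- Conjugating `r ≤ 1` by the square root of `r` gives `r * r ≤ r`, where `r` is the square root of
`T i`. -/
theorem IsPOVM.le_sqrt {T : ι → Matrix d d ℂ} (hT : IsPOVM T) (i : ι) :
    T i ≤ CFC.sqrt (T i) := by
  set r := CFC.sqrt (T i) with hr
  have hs : CFC.sqrt r * CFC.sqrt r = r := CFC.sqrt_mul_sqrt_self r (CFC.sqrt_nonneg _)
  have h := posSemidef_mul_mul_self (Matrix.le_iff.1 (hT.sqrt_le_one i)) (isHermitian_sqrt r)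
  rw [Matrix.le_iff, ← hT.sqrt_mul_sqrt i, ← hr]
  have hrs : CFC.sqrt r * r * CFC.sqrt r = r * r := by
    symm
    calc r * r = (CFC.sqrt r * CFC.sqrt r) * (CFC.sqrt r * CFC.sqrt r) := by rw [hs]
      _ = CFC.sqrt r * (CFC.sqrt r * CFC.sqrt r) * CFC.sqrt r := by simp only [mul_assoc]
      _ = _ := by rw [hs]
  rwa [← hr, mul_sub, sub_mul, mul_one, hs, hrs] at h

theorem sqrt_kronecker {M : Matrix d d ℂ} {N : Matrix e e ℂ} (hM : M.PosSemidef)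
    (hN : N.PosSemidef) : CFC.sqrt (M ⊗ₖ N) = CFC.sqrt M ⊗ₖ CFC.sqrt N := by
  refine CFC.sqrt_unique ?_ ?_
  · rw [← Matrix.mul_kronecker_mul, CFC.sqrt_mul_sqrt_self M hM.nonneg,
      CFC.sqrt_mul_sqrt_self N hN.nonneg]
  · exact ((Matrix.nonneg_iff_posSemidef.1 (CFC.sqrt_nonneg M)).kronecker
      (Matrix.nonneg_iff_posSemidef.1 (CFC.sqrt_nonneg N))).nonneg

theorem IsPOVM.nonempty [Nonempty d] {T : ι → Matrix d d ℂ} (hT : IsPOVM T) : Nonempty ι := by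
  by_contra h
  rw [not_nonempty_iff] at h
  have h1 := hT.2
  rw [Finset.univ_eq_empty, Finset.sum_empty] at h1
  exact zero_ne_one h1

/-- The nonselective Lüders update of the observable `M` by the measurement `T`. -/
noncomputable def luders (T : ι → Matrix d d ℂ) (M : Matrix d d ℂ) : Matrix d d ℂ :=
  ∑ i, CFC.sqrt (T i) * M * CFC.sqrt (T i)

theorem trace_mul_partialTraceLeft {d e : Type*} [Fintype d] [DecidableEq d] [Fintype e]
    (W : Matrix e e ℂ) (M : Matrix (d × e) (d × e) ℂ) :
    (W * partialTraceLeft M).trace = (((1 : Matrix d d ℂ) ⊗ₖ W) * M).trace := by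
  have hL : (W * partialTraceLeft M).trace = ∑ j, ∑ k, ∑ i, W j k * M (i, k) (i, j) := by
    simp [Matrix.trace, Matrix.mul_apply, partialTraceLeft, Finset.mul_sum]
  have hR : (((1 : Matrix d d ℂ) ⊗ₖ W) * M).trace = ∑ i, ∑ j, ∑ k, W j k * M (i, k) (i, j) := by
    simp [Matrix.trace, Matrix.mul_apply, Fintype.sum_prod_type, Matrix.one_apply]
  rw [hL, hR, Finset.sum_comm (s := Finset.univ (α := d))]
  exact Finset.sum_congr rfl fun j _ => Finset.sum_comm

/-- The expectation `Re Tr ((M ⊗ W) γ)` as a bilinear form. -/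
noncomputable def expectation (γ : Matrix (d × e) (d × e) ℂ) :
    Matrix d d ℂ →ₗ[ℝ] Matrix e e ℂ →ₗ[ℝ] ℝ :=
  LinearMap.mk₂ ℝ (fun M W => ((M ⊗ₖ W) * γ).trace.re)
    (fun M M' W => by simp [Matrix.add_kronecker, add_mul])
    (fun c M W => by simp [Matrix.smul_kronecker])
    (fun M W W' => by simp [Matrix.kronecker_add, add_mul])
    (fun c M W => by simp [Matrix.kronecker_smul])

theorem expectation_apply (γ : Matrix (d × e) (d × e) ℂ) (M : Matrix d d ℂ) (W : Matrix e e ℂ) :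
    expectation γ M W = ((M ⊗ₖ W) * γ).trace.re := rfl

theorem expectation_nonneg {γ : Matrix (d × e) (d × e) ℂ} (hγ : γ.PosSemidef) {M : Matrix d d ℂ}
    {W : Matrix e e ℂ} (hM : M.PosSemidef) (hW : W.PosSemidef) : 0 ≤ expectation γ M W :=
  (Complex.nonneg_iff.1 (trace_mul_nonneg (hM.kronecker hW) hγ)).1

theorem expectation_one_one {γ : Matrix (d × e) (d × e) ℂ} (hγ : IsDensity γ) :
    expectation γ 1 1 = 1 := by
  simp [expectation_apply, hγ.2]

end Matrices

/-! ### Guessable measurements disturb little. -/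

section Disturbance

variable {ι X Y d e : Type*} [Fintype ι] [Fintype X] [Fintype Y]
  [Fintype d] [DecidableEq d] [Fintype e] [DecidableEq e]

/-- The difference of the two sides is `H * M * H` with `H = t • (u - v) - (u + v)`. This is the
polarized Cauchy–Schwarz inequality, with the parameter `t` left to be optimized after summation. -/
theorem two_mul_sub_le {u v M : Matrix d d ℂ} (hu : u.IsHermitian) (hv : v.IsHermitian)
    (hM : M.PosSemidef) (t : ℝ) :
    (2 * t) • (u * M * u - v * M * v) ≤
      t ^ 2 • ((u - v) * M * (u - v)) + (u + v) * M * (u + v) := by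
  have hH : (t • (u - v) - (u + v)).IsHermitian := by
    refine Matrix.IsHermitian.sub ?_ (hu.add hv)
    simp [Matrix.IsHermitian, Matrix.conjTranspose_smul, (hu.sub hv).eq]
  have h := posSemidef_mul_mul_self hM hH
  have he : (t • (u - v) - (u + v)) * M * (t • (u - v) - (u + v)) =
      t ^ 2 • ((u - v) * M * (u - v)) + (u + v) * M * (u + v) -
        (2 * t) • (u * M * u - v * M * v) := by
    simp only [sub_mul, mul_sub, add_mul, mul_add, smul_sub, smul_add, smul_mul_assoc,
      mul_smul_comm]
    module
  rwa [Matrix.le_iff, ← he]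

/-- If the outcome of the measurement `R` of the first player can be guessed by the measurement
`W` of the second player, then measuring `R` hardly affects the joint outcome distribution of `Z`
and `S y = ∑ x, W x y`. -/
theorem sq_sum_abs_expectation_luders_le {γ : Matrix (d × e) (d × e) ℂ} (hγ : IsDensity γ)
    {R : X → Matrix d d ℂ} (hR : IsPOVM R) {Z : ι → Matrix d d ℂ} (hZ : IsPOVM Z)
    {S : Y → Matrix e e ℂ} (hS : IsPOVM S) {W : X → Y → Matrix e e ℂ}
    (hW : ∀ x y, (W x y).PosSemidef) (hWS : ∀ y, ∑ x, W x y = S y) :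
    (∑ z, ∑ y, |expectation γ (Z z) (S y) - expectation γ (luders R (Z z)) (S y)|) ^ 2 ≤
      8 * (1 - ∑ x, ∑ y, expectation γ (R x) (W x y)) := by
  classical
  set f := expectation γ with hf
  set r : X → Matrix d d ℂ := fun x => CFC.sqrt (R x) with hr
  have hrH : ∀ x, (r x).IsHermitian := fun x => isHermitian_sqrt _
  have hrr : ∀ x, r x * r x = R x := fun x => hR.sqrt_mul_sqrt x
  let u : X → X → Matrix d d ℂ := fun x x' => if x = x' then 1 else 0
  have huH : ∀ x x', (u x x').IsHermitian := fun x x' => by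
    by_cases h : x = x' <;> simp [u, h, Matrix.IsHermitian]
  have hnn : ∀ {M : Matrix d d ℂ} {V : Matrix e e ℂ}, M.PosSemidef → V.PosSemidef → 0 ≤ f M V :=
    fun hM hV => expectation_nonneg hγ.1 hM hV
  have hmono : ∀ {M M' : Matrix d d ℂ} {V : Matrix e e ℂ}, M ≤ M' → V.PosSemidef →
      f M V ≤ f M' V := fun {M M' V} h hV => by
    have := hnn (Matrix.le_iff.1 h) hV
    rw [map_sub, LinearMap.sub_apply] at this
    linarith
  set N : X → Matrix e e ℂ := fun x => ∑ y, W x y with hN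
  have hNp : ∀ x, (N x).PosSemidef := fun x => Matrix.posSemidef_sum _ fun y _ => hW x y
  have hN1 : ∑ x, N x = 1 := by
    rw [hN, Finset.sum_comm]
    simp only [hWS, hS.2]
  have hG : ∑ x, ∑ y, f (R x) (W x y) = ∑ x, f (R x) (N x) := by simp [hN]
  rw [hG]
  -- The overlap of the families `u` and `r`; it dominates the guessing probability because `R x ≤ r
  -- x`.
  set F := ∑ x, f (r x) (N x) with hF
  have hF1 : F ≤ 1 := by
    calc F ≤ ∑ x, f 1 (N x) := Finset.sum_le_sum fun x _ => hmono (hR.sqrt_le_one x) (hNp x)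
      _ = 1 := by rw [← map_sum, hN1]; exact expectation_one_one hγ
  have hF2 : ∑ x, f (R x) (N x) ≤ F :=
    Finset.sum_le_sum fun x _ => hmono (hR.le_sqrt x) (hNp x)
  set C := ∑ z, ∑ y, |f (Z z) (S y) - f (luders R (Z z)) (S y)| with hC
  have hpt : ∀ z y, f (Z z) (S y) - f (luders R (Z z)) (S y) =
      ∑ x, ∑ x', f (u x x' * Z z * u x x' - r x * Z z * r x) (W x' y) := fun z y => by
    have h1 : ∀ x, ∑ x', f (u x x' * Z z * u x x') (W x' y) = f (Z z) (W x y) := fun x => by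
      rw [Finset.sum_eq_single x]
      · simp [u]
      · intro x' _ hx
        simp [u, hx.symm]
      · simp
    simp only [map_sub, LinearMap.sub_apply, Finset.sum_sub_distrib, h1]
    simp only [← map_sum, hWS]
    simp only [← LinearMap.sum_apply, ← map_sum]
    rfl
  have hU : ∀ x x', u x x' * u x x' = u x x' := fun x x' => by
    by_cases h : x = x' <;> simp [u, h]
  have hcomm : ∀ x x', u x x' * r x = r x * u x x' := fun x x' => by
    by_cases h : x = x' <;> simp [u, h]
  have hsumu : ∑ x, ∑ x', f (u x x') (N x') = 1 := by
    have h1 : ∀ x, ∑ x', f (u x x') (N x') = f 1 (N x) := fun x => by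
      rw [Finset.sum_eq_single x]
      · simp [u]
      · intro x' _ hx
        simp [u, hx.symm]
      · simp
    simp only [h1]
    rw [← map_sum, hN1]
    exact expectation_one_one hγ
  have hsumr : ∑ x, ∑ x', f (u x x' * r x) (N x') = F := by
    refine Finset.sum_congr rfl fun x _ => ?_
    rw [Finset.sum_eq_single x]
    · simp [u]
    · intro x' _ hx
      simp [u, hx.symm]
    · simp
  have hsumR : ∑ x, ∑ x', f (R x) (N x') = 1 := by
    simp only [← map_sum, hN1]
    rw [← LinearMap.sum_apply, ← map_sum, hR.2]
    exact expectation_one_one hγ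
  have hZs : ∀ H : Matrix d d ℂ, ∑ z, H * Z z * H = H * H := fun H => by
    rw [← Finset.sum_mul, ← Finset.mul_sum, hZ.2, mul_one]
  have key : ∀ t : ℝ, 2 * t * C ≤ t ^ 2 * (2 - 2 * F) + (2 + 2 * F) := fun t => by
    have hb : ∀ z y, 2 * t * |f (Z z) (S y) - f (luders R (Z z)) (S y)| ≤
        ∑ x, ∑ x', f (t ^ 2 • ((u x x' - r x) * Z z * (u x x' - r x)) +
          (u x x' + r x) * Z z * (u x x' + r x)) (W x' y) := fun z y => by
      -- The bound depends on `s` only through `s ^ 2`, so `s = t` and `s = -t` together control the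
      -- absolute value.
      have h1 : ∀ s : ℝ, 2 * s * (f (Z z) (S y) - f (luders R (Z z)) (S y)) ≤
        ∑ x, ∑ x', f (s ^ 2 • ((u x x' - r x) * Z z * (u x x' - r x)) +
          (u x x' + r x) * Z z * (u x x' + r x)) (W x' y) := fun s => by
        rw [hpt, Finset.mul_sum]
        refine Finset.sum_le_sum fun x _ => ?_
        rw [Finset.mul_sum]
        refine Finset.sum_le_sum fun x' _ => ?_
        have := hmono (two_mul_sub_le (huH x x') (hrH x) (hZ.1 z) s) (hW x' y)
        rwa [map_smul, LinearMap.smul_apply, smul_eq_mul] at this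
      rcases abs_cases (f (Z z) (S y) - f (luders R (Z z)) (S y)) with ⟨h, -⟩ | ⟨h, -⟩
      · rw [h]; exact h1 t
      · have := h1 (-t)
        rw [neg_sq] at this
        rw [h]; linarith
    have hsum : ∑ z, ∑ y, ∑ x, ∑ x', f (t ^ 2 • ((u x x' - r x) * Z z * (u x x' - r x)) +
          (u x x' + r x) * Z z * (u x x' + r x)) (W x' y) =
        ∑ x, ∑ x', f (t ^ 2 • ((u x x' - r x) * (u x x' - r x)) +
          (u x x' + r x) * (u x x' + r x)) (N x') := by
      have h2 : ∀ x x', f (t ^ 2 • ((u x x' - r x) * (u x x' - r x)) +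
          (u x x' + r x) * (u x x' + r x)) (N x') = ∑ z, ∑ y,
          f (t ^ 2 • ((u x x' - r x) * Z z * (u x x' - r x)) +
          (u x x' + r x) * Z z * (u x x' + r x)) (W x' y) := fun x x' => by
        simp only [← map_sum]
        rw [← LinearMap.sum_apply, ← map_sum, Finset.sum_add_distrib, ← Finset.smul_sum, hZs, hZs]
      simp only [h2]
      calc _ = ∑ z, ∑ x, ∑ y, ∑ x', f (t ^ 2 • ((u x x' - r x) * Z z * (u x x' - r x)) +
            (u x x' + r x) * Z z * (u x x' + r x)) (W x' y) :=
            Finset.sum_congr rfl fun z _ => Finset.sum_comm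
        _ = ∑ x, ∑ z, ∑ y, ∑ x', f (t ^ 2 • ((u x x' - r x) * Z z * (u x x' - r x)) +
            (u x x' + r x) * Z z * (u x x' + r x)) (W x' y) := Finset.sum_comm
        _ = ∑ x, ∑ z, ∑ x', ∑ y, f (t ^ 2 • ((u x x' - r x) * Z z * (u x x' - r x)) +
            (u x x' + r x) * Z z * (u x x' + r x)) (W x' y) :=
            Finset.sum_congr rfl fun x _ => Finset.sum_congr rfl fun z _ => Finset.sum_comm
        _ = _ := Finset.sum_congr rfl fun x _ => Finset.sum_comm
    calc 2 * t * C = ∑ z, ∑ y, 2 * t * |f (Z z) (S y) - f (luders R (Z z)) (S y)| := by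
          simp only [hC, Finset.mul_sum]
      _ ≤ _ := Finset.sum_le_sum fun z _ => Finset.sum_le_sum fun y _ => hb z y
      _ = _ := hsum
      _ = ∑ x, ∑ x', ((t ^ 2 + 1) * f (u x x') (N x') + (t ^ 2 + 1) * f (R x) (N x') +
            (2 - 2 * t ^ 2) * f (u x x' * r x) (N x')) := by
          refine Finset.sum_congr rfl fun x _ => Finset.sum_congr rfl fun x' _ => ?_
          simp only [sub_mul, mul_sub, add_mul, mul_add, hU, hrr, ← hcomm, map_add, map_sub,
            map_smul, LinearMap.add_apply, LinearMap.sub_apply, LinearMap.smul_apply, smul_eq_mul]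
          ring
      _ = _ := by
          simp only [Finset.sum_add_distrib, ← Finset.mul_sum, hsumu, hsumr, hsumR]
          ring
  -- The quadratic is nonnegative by `key`, after weakening `2 - 2 * F` through `hF2` and `2 + 2 *
  -- F` to `4` through `hF1`.
  have hd := discrim_le_zero (a := 2 * (1 - ∑ x, f (R x) (N x))) (b := -(2 * C)) (c := 4)
    fun t => by
      have h1 := key t
      have h2 := mul_le_mul_of_nonneg_left hF2 (sq_nonneg t)
      nlinarith
  rw [discrim] at hd
  linarith

end Disturbance

/-! ### From distinguishability to refinements of a measurement. -/

section Guessing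

variable {d e : Type*} [Fintype d] [DecidableEq d] [Fintype e] [DecidableEq e]

/-- By cyclicity of the trace the two roots of `M` meet, since nothing stands between them on the
traced-out factor, whereas the roots of `N` enclose `T`. -/
theorem trace_mul_partialTraceLeft_sqrt {M : Matrix d d ℂ} {N : Matrix e e ℂ}
    (hM : M.PosSemidef) (hN : N.PosSemidef) (T : Matrix e e ℂ)
    (γ : Matrix (d × e) (d × e) ℂ) :
    (T * partialTraceLeft (CFC.sqrt (M ⊗ₖ N) * γ * CFC.sqrt (M ⊗ₖ N))).trace =
      ((M ⊗ₖ (CFC.sqrt N * T * CFC.sqrt N)) * γ).trace := by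
  rw [trace_mul_partialTraceLeft, sqrt_kronecker hM hN, ← mul_assoc, ← mul_assoc,
    Matrix.trace_mul_comm, ← mul_assoc, ← mul_assoc, ← Matrix.mul_kronecker_mul,
    ← Matrix.mul_kronecker_mul, mul_one, CFC.sqrt_mul_sqrt_self M hM.nonneg]

variable {A B X Y : Type*} [Fintype X] [Fintype Y]

/-- An optimal guess of the outcome of the first player, made after the measurement `S b` of the
second player, amounts to a refinement of `S b`. -/
theorem Strategy.exists_refinement (Γ : Strategy A B X Y d e) (a : A) (b : B) :
    ∃ W : X → Y → Matrix e e ℂ, (∀ x y, (W x y).PosSemidef) ∧ (∀ y, ∑ x, W x y = Γ.S b y) ∧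
      ∑ x, ∑ y, expectation Γ.γ (Γ.R a x) (W x y) =
        ∑ y, distinguishability fun x => Γ.secondPlayerState a b x y := by
  have : Nonempty (d × e) := Γ.isDensity_γ.nonempty
  have : Nonempty d := ⟨(Classical.arbitrary (d × e)).1⟩
  have : Nonempty X := (Γ.isPOVM_R a).nonempty
  have h := fun y => (isGreatest_distinguishability fun x => Γ.secondPlayerState a b x y).1
  choose T hT hTd using h
  refine ⟨fun x y => CFC.sqrt (Γ.S b y) * T y x * CFC.sqrt (Γ.S b y),
    fun x y => posSemidef_mul_mul_self ((hT y).1 x) (isHermitian_sqrt _), fun y => ?_, ?_⟩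
  · rw [← Finset.sum_mul, ← Finset.mul_sum, (hT y).2, mul_one, (Γ.isPOVM_S b).sqrt_mul_sqrt]
  · rw [Finset.sum_comm]
    refine Finset.sum_congr rfl fun y _ => ?_
    rw [hTd y]
    refine Finset.sum_congr rfl fun x _ => ?_
    exact congrArg Complex.re (trace_mul_partialTraceLeft_sqrt
      ((Γ.isPOVM_R a).1 x) ((Γ.isPOVM_S b).1 y) (T y x) Γ.γ).symm

end Guessing

/-! ### Joint measurability and sequential measurement. -/

section JointMeasurability

variable {A X d : Type*} [DecidableEq d]

open scoped Classical in
/-- A family of measurements is jointly measurable if all of them can be obtained by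
post-processing the outcome of a single measurement. -/
def IsJointlyMeasurable (P : A → X → Matrix d d ℂ) : Prop :=
  ∃ (m : ℕ) (J : Fin m → Matrix d d ℂ) (g : Fin m → A → X), IsPOVM J ∧
    ∀ a x, P a x = ∑ k, if g k a = x then J k else 0

open scoped Classical in
theorem isJointlyMeasurable_of_fintype {Λ : Type*} [Fintype Λ] {P : A → X → Matrix d d ℂ}
    {J : Λ → Matrix d d ℂ} (g : Λ → A → X) (hJ : IsPOVM J)
    (h : ∀ a x, P a x = ∑ k, if g k a = x then J k else 0) : IsJointlyMeasurable P := by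
  refine ⟨Fintype.card Λ, J ∘ (Fintype.equivFin Λ).symm, g ∘ (Fintype.equivFin Λ).symm,
    ⟨fun k => hJ.1 _, ?_⟩, fun a x => ?_⟩
  · rw [← hJ.2]
    exact (Fintype.equivFin Λ).symm.sum_comp J
  · rw [h]
    exact ((Fintype.equivFin Λ).symm.sum_comp fun k => if g k a = x then J k else 0).symm

theorem IsJointlyMeasurable.isPOVM [Fintype X] {P : A → X → Matrix d d ℂ} (hP : IsJointlyMeasurable P)
    (a : A) : IsPOVM (P a) := by
  classical
  obtain ⟨m, J, g, hJ, h⟩ := hP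
  refine ⟨fun x => ?_, ?_⟩
  · rw [h]
    refine Matrix.posSemidef_sum _ fun k _ => ?_
    split_ifs
    · exact hJ.1 k
    · exact Matrix.PosSemidef.zero
  · simp only [h]
    rw [Finset.sum_comm]
    simpa using hJ.2

theorem exists_isJointlyMeasurable (A X d : Type*) [Nonempty X] [DecidableEq d] : ∃ P : A → X → Matrix d d ℂ, IsJointlyMeasurable P := by
  classical
  refine ⟨_, isJointlyMeasurable_of_fintype (Λ := Unit) (J := fun _ => 1)
    (fun _ _ => Classical.arbitrary X) ⟨fun _ => Matrix.PosSemidef.one, by simp⟩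
    fun a x => rfl⟩

/-- Measuring `R` first and continuing with a joint measurement of `P` is a joint measurement of
`R` and of the disturbed `P`. -/
theorem IsJointlyMeasurable.update_luders [Fintype X] [Fintype d] [DecidableEq A]
    {P : A → X → Matrix d d ℂ}
    (hP : IsJointlyMeasurable P) {R : X → Matrix d d ℂ} (hR : IsPOVM R) (j : A) :
    IsJointlyMeasurable (Function.update (fun a x => luders R (P a x)) j R) := by
  classical
  obtain ⟨m, J, g, hJ, h⟩ := hP
  refine isJointlyMeasurable_of_fintype (Λ := X × Fin m)
    (J := fun q => CFC.sqrt (R q.1) * J q.2 * CFC.sqrt (R q.1))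
    (fun q => Function.update (g q.2) j q.1)
    ⟨fun q => posSemidef_mul_mul_self (hJ.1 _) (isHermitian_sqrt _), ?_⟩ fun a x => ?_
  · simp only [Fintype.sum_prod_type, ← Finset.sum_mul, ← Finset.mul_sum, hJ.2, mul_one,
      hR.sqrt_mul_sqrt, hR.2]
  · by_cases ha : a = j
    · subst ha
      simp only [Function.update_self, Fintype.sum_prod_type]
      rw [Finset.sum_eq_single x]
      · simp only [if_true, ← Finset.sum_mul, ← Finset.mul_sum, hJ.2, mul_one,
          hR.sqrt_mul_sqrt]
      · intro x' _ hx
        simp [hx]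
      · simp
    · simp only [Function.update_of_ne ha, Fintype.sum_prod_type, luders, h, Finset.mul_sum,
        Finset.sum_mul, mul_ite, ite_mul, mul_zero, zero_mul]

end JointMeasurability

/-! ### Approximation by a jointly measurable family. -/

section Approximation

variable {A B X Y d e : Type*} [Fintype B] [Fintype X] [Fintype Y]
  [Fintype d] [DecidableEq d] [Fintype e] [DecidableEq e]

/-- If every measurement `R j` disturbs the joint statistics with the second player by at most
`ε j`, then measuring the `R j` one after the other, in order of increasing `ε j`, approximates
all of them by a jointly measurable family. -/
theorem exists_isJointlyMeasurable_sum_le [Nonempty X] (γ : Matrix (d × e) (d × e) ℂ)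
    {R : A → X → Matrix d d ℂ} (hR : ∀ a, IsPOVM (R a)) (S : B → Y → Matrix e e ℂ) {ε : A → ℝ}
    (hε : ∀ j, ∀ Z : X → Matrix d d ℂ, IsPOVM Z → ∑ b, ∑ x, ∑ y,
      |expectation γ (Z x) (S b y) - expectation γ (luders (R j) (Z x)) (S b y)| ≤ ε j)
    (s : Finset A) :
    ∃ P : A → X → Matrix d d ℂ, IsJointlyMeasurable P ∧
      ∑ a ∈ s, ∑ b, ∑ x, ∑ y,
        |expectation γ (R a x) (S b y) - expectation γ (P a x) (S b y)| ≤
        s.card / 2 * ∑ a ∈ s, ε a := by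
  classical
  have hε0 : ∀ j, 0 ≤ ε j := fun j => le_trans (by positivity) (hε j (R j) (hR j))
  -- The element inserted last has the smallest `ε` and is measured first. It therefore acts on the
  -- undisturbed `γ`, and `hε` applies to the already modified measurement `P a`.
  induction s using Finset.induction_on_min_value ε with
  | empty =>
    obtain ⟨P, hP⟩ := exists_isJointlyMeasurable A X d
    exact ⟨P, hP, by simp⟩
  | insert j s hj hmin ih =>
    obtain ⟨P, hP, h⟩ := ih
    refine ⟨_, hP.update_luders (hR j) j, ?_⟩
    rw [Finset.sum_insert hj, Finset.sum_insert hj, Finset.card_insert_of_notMem hj]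
    have h1 : ∀ a ∈ s, ∑ b, ∑ x, ∑ y, |expectation γ (R a x) (S b y) - expectation γ
        (Function.update (fun a x => luders (R j) (P a x)) j (R j) a x) (S b y)| ≤
        ∑ b, ∑ x, ∑ y, |expectation γ (R a x) (S b y) - expectation γ (P a x) (S b y)| +
          ε j := fun a ha => by
      have haj : a ≠ j := fun h => hj (h ▸ ha)
      refine le_trans ?_ (add_le_add_right (hε j (P a) (hP.isPOVM a)) _)
      simp only [← Finset.sum_add_distrib, Function.update_of_ne haj]
      exact Finset.sum_le_sum fun b _ => Finset.sum_le_sum fun x _ => Finset.sum_le_sum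
        fun y _ => abs_sub_le _ _ _
    have h2 := Finset.sum_le_sum h1
    rw [Finset.sum_add_distrib, Finset.sum_const, nsmul_eq_mul] at h2
    -- Minimality of `ε j` allows half of the new error `s.card * ε j` to be charged to the sum over
    -- `s`; this produces the factor `1 / 2`.
    have h3 : s.card * ε j ≤ ∑ a ∈ s, ε a := by
      simpa using Finset.card_nsmul_le_sum s ε (ε j) hmin
    simp only [Function.update_self, sub_self, abs_zero, Finset.sum_const_zero, zero_add]
    refine h2.trans ?_
    push_cast
    linarith [hε0 j]

end Approximation

/-! ### Jointly measurable families give classical correlations. -/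

section Classical

theorem exists_isDensity_smul {e : Type*} [Fintype e] [Nonempty e] {τ : Matrix e e ℂ}
    (hτ : τ.PosSemidef) : ∃ ω : Matrix e e ℂ, IsDensity ω ∧ τ = τ.trace.re • ω := by
  classical
  by_cases h : τ.trace = 0
  -- A positive semidefinite operator of trace zero vanishes, so any density operator serves here,
  -- with weight zero.
  · refine ⟨Matrix.diagonal (Pi.single (Classical.arbitrary e) 1), ⟨?_, ?_⟩, ?_⟩
    · refine Matrix.PosSemidef.diagonal fun i => ?_
      by_cases hi : i = Classical.arbitrary e
      · subst hi; simp
      · simp [hi]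
    · simp [Matrix.trace_diagonal]
    · simp [hτ.trace_eq_zero_iff.1 h]
  · have hre : ((τ.trace.re : ℝ) : ℂ) = τ.trace :=
      Complex.ext rfl (Complex.nonneg_iff.1 hτ.trace_nonneg).2
    have hre0 : τ.trace.re ≠ 0 := fun h0 => h (by rw [← hre, h0, Complex.ofReal_zero])
    refine ⟨τ.trace.re⁻¹ • τ, ⟨?_, ?_⟩, ?_⟩
    · exact hτ.smul (inv_nonneg.2 (Complex.nonneg_iff.1 hτ.trace_nonneg).1)
    · rw [Matrix.trace_smul, Complex.real_smul, Complex.ofReal_inv, hre, inv_mul_cancel₀ h]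
    · rw [smul_inv_smul₀ hre0]

theorem isSeparable_sum_kronecker {ι d e : Type*} [Fintype ι] [Fintype d] [Fintype e]
    [Nonempty e] {σ : ι → Matrix d d ℂ} {τ : ι → Matrix e e ℂ} (hσ : ∀ k, IsDensity (σ k))
    (hτ : ∀ k, (τ k).PosSemidef) (h1 : ∑ k, (τ k).trace = 1) :
    IsSeparable (∑ k, σ k ⊗ₖ τ k) := by
  choose ω hω hωτ using fun k => exists_isDensity_smul (hτ k)
  have h : ∑ k, σ k ⊗ₖ τ k = ∑ k, (τ k).trace.re • (σ k ⊗ₖ ω k) := by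
    refine Finset.sum_congr rfl fun k _ => ?_
    rw [← Matrix.kronecker_smul, ← hωτ]
  rw [h, IsSeparable]
  refine (convex_convexHull ℝ _).sum_mem
    (fun k _ => (Complex.nonneg_iff.1 (hτ k).trace_nonneg).1) ?_
    fun k _ => subset_convexHull ℝ _ ⟨σ k, ω k, hσ k, hω k, rfl⟩
  rw [← Complex.re_sum, h1, Complex.one_re]

theorem isDensity_sum_kronecker {ι d e : Type*} [Fintype ι] [Fintype d] [Fintype e]
    {σ : ι → Matrix d d ℂ} {τ : ι → Matrix e e ℂ} (hσ : ∀ k, IsDensity (σ k))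
    (hτ : ∀ k, (τ k).PosSemidef) (h1 : ∑ k, (τ k).trace = 1) :
    IsDensity (∑ k, σ k ⊗ₖ τ k) := by
  refine ⟨Matrix.posSemidef_sum _ fun k _ => (hσ k).1.kronecker (hτ k), ?_⟩
  simp only [Matrix.trace_sum, Matrix.trace_kronecker, (hσ _).2, one_mul, h1]

theorem trace_submatrix_equiv {m n : Type*} [Fintype m] [Fintype n] (M : Matrix n n ℂ)
    (f : m ≃ n) : (M.submatrix f f).trace = M.trace :=
  f.sum_comp fun i => M i i

theorem IsPOVM.submatrix {ι m n : Type*} [Fintype ι] [DecidableEq m] [DecidableEq n]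
    {T : ι → Matrix n n ℂ} (hT : IsPOVM T) (f : m ≃ n) :
    IsPOVM fun i => (T i).submatrix f f := by
  refine ⟨fun i => (hT.1 i).submatrix f, ?_⟩
  rw [← Matrix.submatrix_one_equiv f, ← hT.2]
  ext i j
  simp [Matrix.sum_apply]

variable {A B X Y d e : Type*} [Fintype X] [Fintype Y]
  [Fintype d] [DecidableEq d] [Fintype e] [DecidableEq e]

/-- If the measurements of the first player are replaced by jointly measurable ones, then the
correlation becomes classical. -/
theorem Strategy.exists_isClassical (Γ : Strategy A B X Y d e) {P : A → X → Matrix d d ℂ}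
    (hP : IsJointlyMeasurable P) : ∃ p : Correlation A B X Y, p.IsClassical ∧
      ∀ a b x y, p.prob a b x y = expectation Γ.γ (P a x) (Γ.S b y) := by
  classical
  obtain ⟨m, J, g, hJ, hg⟩ := hP
  have : Nonempty (d × e) := Γ.isDensity_γ.nonempty
  have : Nonempty e := ⟨(Classical.arbitrary (d × e)).2⟩
  let f := (Fintype.equivFin e).symm
  have : Nonempty (Fin (Fintype.card e)) := f.nonempty
  -- The unnormalized state left to the second player when the joint measurement yields `k`. In `Γ'`
  -- the first player holds the record `k` in a diagonal register and answers `g k a`.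
  let ρ : Fin m → Matrix e e ℂ := fun k => partialTraceLeft
    (CFC.sqrt (J k ⊗ₖ 1) * Γ.γ * CFC.sqrt (J k ⊗ₖ 1))
  have hρ : ∀ k, (ρ k).PosSemidef := fun k =>
    posSemidef_partialTraceLeft (posSemidef_mul_mul_self Γ.isDensity_γ.1 (isHermitian_sqrt _))
  have hρt : ∀ k (W : Matrix e e ℂ), (W * ρ k).trace = ((J k ⊗ₖ W) * Γ.γ).trace :=
    fun k W => by
    have h := trace_mul_partialTraceLeft_sqrt (hJ.1 k)
      (Matrix.PosSemidef.one : (1 : Matrix e e ℂ).PosSemidef) W Γ.γ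
    rwa [CFC.sqrt_one, one_mul, mul_one] at h
  let τ : Fin m → Matrix (Fin (Fintype.card e)) (Fin (Fintype.card e)) ℂ :=
    fun k => (ρ k).submatrix f f
  have hτ : ∀ k, (τ k).PosSemidef := fun k => (hρ k).submatrix f
  have hτ1 : ∑ k, (τ k).trace = 1 := by
    have h : ∀ k, (τ k).trace = ((J k ⊗ₖ (1 : Matrix e e ℂ)) * Γ.γ).trace := fun k => by
      rw [trace_submatrix_equiv, ← hρt, one_mul]
    have hs : ∑ k, J k ⊗ₖ (1 : Matrix e e ℂ) = 1 := by
      rw [← Matrix.one_kronecker_one, ← hJ.2]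
      ext i j
      simp [Matrix.sum_apply, Finset.sum_mul]
    simp only [h]
    rw [← Matrix.trace_sum, ← Finset.sum_mul, hs, one_mul, Γ.isDensity_γ.2]
  let σ : Fin m → Matrix (Fin m) (Fin m) ℂ := fun k => Matrix.diagonal (Pi.single k 1)
  have hσ : ∀ k, IsDensity (σ k) := fun k => by
    refine ⟨Matrix.PosSemidef.diagonal fun i => ?_, by simp [σ, Matrix.trace_diagonal]⟩
    by_cases hi : i = k
    · subst hi; simp
    · simp [hi]
  let Γ' : Strategy A B X Y (Fin m) (Fin (Fintype.card e)) :=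
    { R := fun a x => Matrix.diagonal fun k => if g k a = x then 1 else 0
      S := fun b y => (Γ.S b y).submatrix f f
      γ := ∑ k, σ k ⊗ₖ τ k
      isPOVM_R := fun a => by
        refine ⟨fun x => Matrix.PosSemidef.diagonal fun k => ?_, ?_⟩
        · by_cases h : g k a = x <;> simp [h]
        · ext i j
          by_cases h : i = j
          · subst h; simp [Matrix.sum_apply]
          · simp [Matrix.sum_apply, h]
      isPOVM_S := fun b => (Γ.isPOVM_S b).submatrix f
      isDensity_γ := isDensity_sum_kronecker hσ hτ hτ1 }
  refine ⟨Γ'.correlation, ⟨_, _, Γ', isSeparable_sum_kronecker hσ hτ hτ1, rfl⟩,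
    fun a b x y => ?_⟩
  have h1 : ((Γ'.R a x ⊗ₖ Γ'.S b y) * Γ'.γ).trace =
      ∑ k, if g k a = x then ((J k ⊗ₖ Γ.S b y) * Γ.γ).trace else 0 := by
    change ((_ ⊗ₖ _) * ∑ k, σ k ⊗ₖ τ k).trace = _
    rw [Finset.mul_sum, Matrix.trace_sum]
    refine Finset.sum_congr rfl fun k _ => ?_
    rw [← Matrix.mul_kronecker_mul, Matrix.trace_kronecker, Matrix.submatrix_mul_equiv,
      trace_submatrix_equiv, hρt, Matrix.diagonal_mul_diagonal, Matrix.trace_diagonal]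
    simp [Pi.single_apply]
  change (((Γ'.R a x ⊗ₖ Γ'.S b y) * Γ'.γ).trace).re = _
  rw [h1, hg, map_sum, LinearMap.sum_apply, Complex.re_sum]
  refine Finset.sum_congr rfl fun k _ => ?_
  split_ifs
  · rfl
  · simp

end Classical

/-- If the second player can on average guess the output of the first player with error `δ`, then
the correlation is close to a classical one. -/
theorem Strategy.exists_isClassical_sum_abs_sub_le {A B X Y d e : Type*}
    [Fintype A] [Nonempty A] [Fintype B] [Nonempty B] [Fintype X] [Fintype Y]
    [Fintype d] [DecidableEq d] [Fintype e] [DecidableEq e]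
    (Γ : Strategy A B X Y d e) (δ : ℝ)
    (hδ : δ = 1 - 1 / ((Fintype.card A : ℝ) * (Fintype.card B : ℝ)) *
      ∑ a, ∑ b, ∑ y, distinguishability
        (fun x => Γ.secondPlayerState a b x y)) :
    ∃ p' : Correlation A B X Y, p'.IsClassical ∧
      1 / ((Fintype.card A : ℝ) * (Fintype.card B : ℝ)) *
        ∑ a, ∑ b, ∑ x, ∑ y, |Γ.correlation.prob a b x y - p'.prob a b x y| ≤
      √(3 * δ) * (Fintype.card A : ℝ) := by
  have : Nonempty (d × e) := Γ.isDensity_γ.nonempty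
  have : Nonempty d := ⟨(Classical.arbitrary (d × e)).1⟩
  have : Nonempty X := (Γ.isPOVM_R (Classical.arbitrary A)).nonempty
  set D : A → B → ℝ := fun a b =>
    1 - ∑ y, distinguishability fun x => Γ.secondPlayerState a b x y with hD
  have hdist : ∀ a b (Z : X → Matrix d d ℂ), IsPOVM Z → (∑ x, ∑ y,
      |expectation Γ.γ (Z x) (Γ.S b y) - expectation Γ.γ (luders (Γ.R a) (Z x)) (Γ.S b y)|) ^ 2 ≤
      8 * D a b := fun a b Z hZ => by
    obtain ⟨W, hW, hWS, h⟩ := Γ.exists_refinement a b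
    simp only [hD, ← h]
    exact sq_sum_abs_expectation_luders_le Γ.isDensity_γ (Γ.isPOVM_R a) hZ (Γ.isPOVM_S b) hW hWS
  have hD0 : ∀ a b, 0 ≤ D a b := fun a b => by
    have := (sq_nonneg _).trans (hdist a b _ (Γ.isPOVM_R a))
    linarith
  -- The disturbance caused by `R a` is the sum over `b` of the square roots of the bounds in
  -- `hdist`.
  obtain ⟨P, hP, hle⟩ := exists_isJointlyMeasurable_sum_le Γ.γ Γ.isPOVM_R Γ.S
    (ε := fun a => ∑ b, √(8 * D a b))
    (fun a Z hZ => Finset.sum_le_sum fun b _ => Real.le_sqrt_of_sq_le (hdist a b Z hZ))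
    Finset.univ
  obtain ⟨p, hp, hpP⟩ := Γ.exists_isClassical hP
  refine ⟨p, hp, ?_⟩
  simp only [hpP]
  set n : ℝ := (Fintype.card A : ℝ)
  set k : ℝ := (Fintype.card B : ℝ)
  have hn : 0 < n := Nat.cast_pos.2 Fintype.card_pos
  have hk : 0 < k := Nat.cast_pos.2 Fintype.card_pos
  have hsum : ∑ a, ∑ b, D a b = n * k * δ := by
    simp only [hD, Finset.sum_sub_distrib, Finset.sum_const, Finset.card_univ, nsmul_eq_mul,
      mul_one]
    rw [hδ]
    field_simp
    ring
  have hδ0 : 0 ≤ δ := by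
    refine nonneg_of_mul_nonneg_right ?_ (mul_pos hn hk)
    rw [← hsum]
    exact Finset.sum_nonneg fun a _ => Finset.sum_nonneg fun b _ => hD0 a b
  have hjensen : (∑ a, ∑ b, √(8 * D a b)) ≤ n * k * √(8 * δ) := by
    have h := sq_sum_le_card_mul_sum_sq (s := (Finset.univ : Finset (A × B)))
      (f := fun q => √(8 * D q.1 q.2))
    rw [Finset.card_univ, Fintype.card_prod] at h
    simp only [Real.sq_sqrt (mul_nonneg (by norm_num : (0 : ℝ) ≤ 8) (hD0 _ _)),
      Fintype.sum_prod_type, ← Finset.mul_sum, hsum] at h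
    refine abs_le_of_sq_le_sq' (h.trans_eq ?_) (by positivity) |>.2
    rw [mul_pow, Real.sq_sqrt (by positivity)]
    push_cast
    ring
  calc _ ≤ 1 / (n * k) * (n / 2 * (n * k * √(8 * δ))) := by
        refine mul_le_mul_of_nonneg_left (hle.trans ?_) (by positivity)
        exact mul_le_mul_of_nonneg_left hjensen (by positivity)
    _ = √(8 * δ) / 2 * n := by field_simp
    -- Since `√(8 * δ) / 2 = √(2 * δ)`, the constant `3` leaves some slack.
    _ ≤ _ := by
        refine mul_le_mul_of_nonneg_right ?_ hn.le
        rw [div_le_iff₀ two_pos]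
        refine Real.sqrt_le_iff.2 ⟨by positivity, ?_⟩
        rw [mul_pow, Real.sq_sqrt (by positivity)]
        linarith

end QuantumCorrelation

theorem proposition2 {A B X Y d e : Type*}
    [Fintype A] [Nonempty A] [Fintype B] [Nonempty B] [Fintype X] [Fintype Y]
    [Fintype d] [DecidableEq d] [Fintype e] [DecidableEq e]
    (Γ : QuantumCorrelation.Strategy A B X Y d e) (δ : ℝ)
    (hδ : δ = 1 - 1 / ((Fintype.card A : ℝ) * (Fintype.card B : ℝ)) *
      ∑ a, ∑ b, ∑ y, QuantumCorrelation.distinguishability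
        (fun x => Γ.secondPlayerState a b x y)) :
    ∃ p' : QuantumCorrelation.Correlation A B X Y, p'.IsClassical ∧
      1 / ((Fintype.card A : ℝ) * (Fintype.card B : ℝ)) *
        ∑ a, ∑ b, ∑ x, ∑ y, |Γ.correlation.prob a b x y - p'.prob a b x y| ≤
      √(3 * δ) * (Fintype.card A : ℝ) :=
  Γ.exists_isClassical_sum_abs_sub_le δ hδ
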